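/- Processors $0,1,\ldots,n-1$, with $n\ge 2$, communicate in synchronous rounds; processor $0$ is the start processor and never fails. A fixed set $F\subseteq\{1,\ldots,n-1\}$ of processors, of size $f$, is faulty from the beginning. The randomized $\mathrm{GP}$ algorithm works as follows. Processor $0$ picks a permutation $\pi$ of $\{1,\ldots,n-1\}$ uniformly at random and starts with the list $(\pi(1),\ldots,\pi(n-1))$; all other processors start with the empty list. In each round, each processor $i$ that holds a nonempty list $(j_1,\ldots,j_k)$ sends a request to $j_1$ and deletes $j_1$ from its list. If $j_1\in F$, the request fails and $i$ keeps $(j_2,\ldots,j_k)$. If $j_1\notin F$, then $j_1$ receives the rumor from $i$ together with the list $(j_3,j_5,\ldots)$ of the even-indexed entries of $(j_2,\ldots,j_k)$, and $i$ keeps the list $(j_2,j_4,\ldots)$ of its odd-indexed entries. The time complexity $T$ of an execution is the number of the last round in which a request is sent. Let $\varepsilon=\sqrt{\ln n/(n-1)}$, let $F$ satisfy $f=|F|<(n-1)(1-\varepsilon)$, let $p=1-\frac{f}{n-1}$, and let $c>1$. Then, with $\log$ denoting the logarithm to base $2$, the probability (over $\pi$) that $$T\le\frac{c}{p-\varepsilon}\bigl(\lceil\log(n-1)\rceil+1\bigr)$$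 is at least $$1-\frac{n^3}{n^2-1}\exp\Bigl(-\frac{(c-1)^2}{2c}\bigl(\lceil\log(n-1)\rceil-1\bigr)\Bigr).$$ -/

import Mathlib

namespace GP

/-- `ODD (s₁, s₂, s₃, …) = (s₁, s₃, …)`. -/
def oddPart {α : Type*} : List α → List α
  | [] => []
  | [a] => [a]
  | a :: _ :: l => a :: oddPart l

/-- `EVEN (s₁, s₂, s₃, …) = (s₂, s₄, …)`. -/
def evenPart {α : Type*} : List α → List α
  | [] => []
  | [_] => []
  | _ :: b :: l => b :: evenPart l

/-- A global state between two rounds: the todo-list held by each processor. Processors are the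
numbers `0, …, n - 1`, and `0` is the start processor. -/
abbrev State := ℕ → List ℕ

/-- What processor `u` keeps of its own list `(j₁, …, j_k)` in a round with faulty set `F`:
it sends a request to `j₁`, deletes `j₁`, and, if the request is successful (`j₁` is not faulty),
keeps only the odd-indexed part of the rest. -/
def kept (F : Finset ℕ) (s : State) (u : ℕ) : List ℕ :=
  match s u with
  | [] => []
  | j :: l => if j ∈ F then l else oddPart l

/-- The list appended to the rumor that `u` transfers to `v` in a round (empty if `u` does not
send a successful request to `v` in this round). -/
def sent (F : Finset ℕ) (s : State) (u v : ℕ) : List ℕ :=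
  match s u with
  | [] => []
  | j :: l => if j = v ∧ j ∉ F then evenPart l else []

/-- One synchronous round among the processors `0, …, n - 1`. (A processor that receives the rumor
holds an empty list and is contacted by a single processor, so that the concatenation has at most
one nonempty part.) -/
def step (n : ℕ) (F : Finset ℕ) (s : State) : State := fun v =>
  kept F s v ++ (List.range n).flatMap (fun u => sent F s u v)

/-- Initially processor `0` holds the list `L`, and all other lists are empty. -/
def initial (L : List ℕ) : State := fun v => if v = 0 then L else []

/-- The state after `t` rounds. -/
def stateAfter (n : ℕ) (F : Finset ℕ) (L : List ℕ) : ℕ → State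
  | 0 => initial L
  | t + 1 => step n F (stateAfter n F L t)

/-- The processors with a nonempty list; they are those that send a request in the next round. -/
def active (s : State) : Set ℕ := {u | s u ≠ []}

/-- The execution has time complexity `t`: some request is sent in round `t ≥ 1`,
and none is sent in round `t + 1`. (Round `k + 1` starts from the state after `k` rounds.) -/
def HasTimeComplexity (n : ℕ) (F : Finset ℕ) (L : List ℕ) (t : ℕ) : Prop :=
  ∃ k, t = k + 1 ∧ (active (stateAfter n F L k)).Nonempty ∧
    active (stateAfter n F L (k + 1)) = ∅

/-- The list `(π(1), …, π(n - 1))` of a permutation `π` of `{1, …, n - 1}`; such a permutation is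
given as a permutation of `Fin (n - 1)`, with `i : Fin (n - 1)` standing for `i + 1`. -/
def permList (n : ℕ) (π : Equiv.Perm (Fin (n - 1))) : List ℕ :=
  List.ofFn fun i => (π i : ℕ) + 1

/-- The probability of an event when `π` is a uniformly random permutation of `{1, …, n - 1}`. -/
noncomputable def permProb (n : ℕ) (A : Set (Equiv.Perm (Fin (n - 1)))) : ℝ :=
  ((PMF.uniformOfFintype (Equiv.Perm (Fin (n - 1)))).toOuterMeasure A).toReal

end GP

/-!
The execution is a tree of requests: a processor that contacts `j` with the todo-list `j :: l`
leaves one subtree, for `l`, if `j` is faulty, and two, for the odd and the even part of `l`,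
otherwise. The time complexity is the height `depth` of this tree (`hasTimeComplexity_depth`),
since in an execution the lists stay disjoint and only idle processors are contacted.

A successful request halves the list. So if the height is at least `t`, then along some branch the
first `t` requests contain at most `log (n - 1) + 1` successful ones, and the branch is described
by `⌊log (n - 1)⌋` bits (`exists_branch_of_le_depth`); there are at most `n - 1` branches. For a
fixed bit string, moving the entries contacted along the branch to the front (`explore`) is an
injective map on lists, hence a bijection on the permutations. Therefore the numbers of successes
on a branch are distributed as if the processors were contacted in the order of the random list
(`card_explore_le`), that is, by sampling without replacement.

It remains to bound a lower tail of the hypergeometric distribution. The moment generating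
function of the number of faulty entries expands with nonnegative coefficients into probabilities
that given positions are all faulty, and these are at most the independent ones
(`card_perm_forall_mem_le`, `sum_perm_prod_le`). The usual Chernoff argument then gives
`exp (-(c - 1) ^ 2 / (2 * c) * a)` for the event that at most `a` successes occur among entries
with at least `c * a` expected ones (`card_countP_le_le`), where `a = ⌈log (n - 1)⌉ + 1`. The
union bound over the branches ends the proof.
-/

namespace GP

/-! ### Splitting lists and branches of the request tree -/

lemma length_oddPart {α : Type*} (l : List α) : (oddPart l).length = (l.length + 1) / 2 := by
  induction l using oddPart.induct with
  | case1 => simp [oddPart]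
  | case2 => simp [oddPart]
  | case3 a b l ih => simp only [oddPart, List.length_cons, ih]; omega

lemma length_evenPart {α : Type*} (l : List α) : (evenPart l).length = l.length / 2 := by
  induction l using oddPart.induct with
  | case1 => simp [evenPart]
  | case2 => simp [evenPart]
  | case3 a b l ih => simp only [evenPart, List.length_cons, ih]; omega

lemma oddPart_append_evenPart_perm {α : Type*} (l : List α) :
    (oddPart l ++ evenPart l).Perm l := by
  induction l using oddPart.induct with
  | case1 => simp [oddPart, evenPart]
  | case2 => simp [oddPart, evenPart]
  | case3 a b l ih =>
    simp only [oddPart, evenPart, List.cons_append, List.perm_cons]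
    exact List.perm_middle.trans (ih.cons b)

lemma eq_of_oddPart_eq_of_evenPart_eq {α : Type*} (l l' : List α)
    (ho : oddPart l = oddPart l') (he : evenPart l = evenPart l') : l = l' := by
  induction l using oddPart.induct generalizing l' with
  | case1 =>
    match l' with
    | [] => rfl
    | [_] => simp [oddPart] at ho
    | _ :: _ :: _ => simp [oddPart] at ho
  | case2 a =>
    match l' with
    | [] => simp [oddPart] at ho
    | [_] => simpa [oddPart] using ho
    | _ :: _ :: _ => simp [evenPart] at he
  | case3 a b l ih =>
    match l' with
    | [] => simp [oddPart] at ho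
    | [_] => simp [evenPart] at he
    | a' :: b' :: l' =>
      simp only [oddPart, evenPart, List.cons.injEq] at ho he
      rw [ho.1, he.1, ih l' ho.2 he.2]

lemma mem_of_mem_oddPart {α : Type*} {l : List α} {x : α} (h : x ∈ oddPart l) : x ∈ l :=
  (oddPart_append_evenPart_perm l).subset (List.mem_append_left _ h)

lemma mem_of_mem_evenPart {α : Type*} {l : List α} {x : α} (h : x ∈ evenPart l) : x ∈ l :=
  (oddPart_append_evenPart_perm l).subset (List.mem_append_right _ h)

/-- The number of rounds needed to work off the todo-list `l` by its holder and by all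
processors that receive a part of it: the height of the tree of requests generated by `l`. -/
def depth (F : Finset ℕ) : List ℕ → ℕ
  | [] => 0
  | j :: l => (if j ∈ F then depth F l else max (depth F (oddPart l)) (depth F (evenPart l))) + 1
termination_by l => l.length
decreasing_by
  · simp
  · simp only [length_oddPart, List.length_cons]; omega
  · simp only [length_evenPart, List.length_cons]; omega

lemma depth_eq_zero_iff (F : Finset ℕ) (l : List ℕ) : depth F l = 0 ↔ l = [] := by
  cases l <;> simp [depth]

lemma depth_le_length (F : Finset ℕ) (l : List ℕ) : depth F l ≤ l.length := by
  induction l using depth.induct with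
  | case1 => simp [depth]
  | case2 j l ih₁ ih₂ ih₃ =>
    rw [depth, List.length_cons]
    have h₂ := ih₂
    have h₃ := ih₃
    rw [length_oddPart] at h₂
    rw [length_evenPart] at h₃
    split_ifs
    · omega
    · omega

/-- The part of a list that is followed by a branch of the request tree: the part that is sent
for `true`, the part that is kept for `false`. -/
def half (b : Bool) (l : List ℕ) : List ℕ := if b then evenPart l else oddPart l

lemma length_half_le (b : Bool) (l : List ℕ) : (half b l).length ≤ (l.length + 1) / 2 := by
  cases b
  · exact (length_oddPart l).le
  · exact (length_evenPart l).le.trans (by omega)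

lemma half_append_half_perm (b : Bool) (l : List ℕ) : (half b l ++ half (!b) l).Perm l := by
  cases b
  · exact oddPart_append_evenPart_perm l
  · exact List.perm_append_comm.trans (oddPart_append_evenPart_perm l)

lemma length_half_eq (b : Bool) {l l' : List ℕ} (h : l.length = l'.length) :
    (half b l).length = (half b l').length := by
  cases b <;> simp [half, length_oddPart, length_evenPart, h]

lemma half_injective (b : Bool) {l l' : List ℕ} (h : half b l = half b l')
    (h' : half (!b) l = half (!b) l') : l = l' := by
  cases b
  · exact eq_of_oddPart_eq_of_evenPart_eq l l' h h'
  · exact eq_of_oddPart_eq_of_evenPart_eq l l' h' h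

/-- The list `l` rearranged so that the entries contacted along one branch of its request tree
come first, in the order of contact. The bits `b` say which part of the list the branch follows
after each successful request (`false` once the bits are used up); the other part is put behind. -/
def explore (F : Finset ℕ) : List Bool → List ℕ → List ℕ
  | _, [] => []
  | b, j :: l => j :: (if j ∈ F then explore F b l else
      explore F b.tail (half (b.headD false) l) ++ half (!b.headD false) l)
termination_by _ l => l.length
decreasing_by
  · simp
  · have := length_half_le (b.headD false) l
    simp only [List.length_cons]; omega

lemma explore_perm (F : Finset ℕ) (b : List Bool) (l : List ℕ) : (explore F b l).Perm l := by
  induction b, l using explore.induct with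
  | case1 => simp [explore]
  | case2 b j l ih₁ ih₂ =>
    rw [explore, List.perm_cons]
    split_ifs with hj
    · exact ih₁
    · exact (ih₂.append_right _).trans (half_append_half_perm _ l)

/-- The rearranged list determines the original one: its first entry decides, by being faulty or
not, how the rest was rearranged. -/
lemma explore_injective (F : Finset ℕ) (b : List Bool) : Function.Injective (explore F b) := by
  intro l
  induction b, l using explore.induct with
  | case1 b =>
    intro l' h
    rw [explore] at h
    have hp := explore_perm F b l'
    rw [← h] at hp
    exact hp.nil_eq
  | case2 b j l ih₁ ih₂ =>
    intro l' h
    match l' with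
    | [] => simp [explore] at h
    | j' :: l' =>
      have hlen : l.length = l'.length := by
        have h₁ := (explore_perm F b (j :: l)).length_eq
        have h₂ := (explore_perm F b (j' :: l')).length_eq
        rw [h, h₂] at h₁
        simpa using h₁.symm
      rw [explore, explore, List.cons.injEq] at h
      obtain ⟨rfl, h⟩ := h
      split_ifs at h with hj
      · rw [ih₁ h]
      · obtain ⟨h₁, h₂⟩ := List.append_inj h (by
          rw [(explore_perm F _ _).length_eq, (explore_perm F _ _).length_eq,
            length_half_eq _ hlen])
        rw [half_injective _ (ih₂ h₁) h₂]

/-- A list of length less than `2 ^ (k + 1)` is used up by `k + 1` successful requests. Hence if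
its request tree has height at least `t`, some branch meets at most `k + 1` nonfaulty processors
among its first `t` requests; this branch chooses between two nonempty parts at most `k` times. -/
lemma exists_branch_of_le_depth (F : Finset ℕ) (k t : ℕ) (l : List ℕ)
    (hl : l.length < 2 ^ (k + 1)) (ht : t ≤ depth F l) :
    ∃ b : List Bool, b.length = k ∧ ((explore F b l).take t).countP (· ∉ F) ≤ k + 1 := by
  induction l using depth.induct generalizing k t with
  | case1 => exact ⟨List.replicate k false, by simp, by simp [explore]⟩
  | case2 j l ih₁ ih₂ ih₃ =>
    match t, k with
    | 0, k => exact ⟨List.replicate k false, by simp, by simp⟩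
    | t + 1, 0 =>
      refine ⟨[], rfl, List.countP_le_length.trans ((List.length_take_le' _ _).trans ?_)⟩
      rw [(explore_perm F _ _).length_eq]
      omega
    | t + 1, k + 1 =>
      rw [depth, Nat.add_le_add_iff_right] at ht
      rw [List.length_cons] at hl
      have hpow : 2 ^ (k + 1 + 1) = 2 * 2 ^ (k + 1) := by ring
      by_cases hj : j ∈ F
      · rw [if_pos hj] at ht
        obtain ⟨b, hb, hc⟩ := ih₁ (k + 1) t (by omega) ht
        refine ⟨b, hb, ?_⟩
        rw [explore, if_pos hj, List.take_succ_cons, List.countP_cons_of_neg (by simpa using hj)]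
        exact hc
      · rw [if_neg hj, le_max_iff] at ht
        obtain ⟨x, hx⟩ : ∃ x, t ≤ depth F (half x l) :=
          ht.elim (fun h => ⟨false, h⟩) fun h => ⟨true, h⟩
        have hxl := length_half_le x l
        obtain ⟨b, hb, hc⟩ : ∃ b : List Bool, b.length = k ∧
            ((explore F b (half x l)).take t).countP (· ∉ F) ≤ k + 1 := by
          cases x
          · exact ih₂ k t (by change (half false l).length < _; omega) hx
          · exact ih₃ k t (by change (half true l).length < _; omega) hx
        refine ⟨x :: b, by simp [hb], ?_⟩
        rw [explore, if_neg hj, List.take_succ_cons, List.countP_cons_of_pos (by simpa using hj),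
          List.tail_cons, List.headD_cons, List.take_append_of_le_length]
        · omega
        · rw [(explore_perm F _ _).length_eq]
          exact hx.trans (depth_le_length F _)

/-! ### The execution and the height of the request tree -/

/-- An invariant of the states of an execution on the processors `0, …, n - 1`: the lists are
repetition-free and pairwise disjoint, only processors below `n` hold nonempty lists, and the
processors that are still on some list are below `n` and have not been contacted yet. -/
structure Reachable (n : ℕ) (s : State) : Prop where
  lt_of_ne_nil : ∀ u, s u ≠ [] → u < n
  lt_of_mem : ∀ u, ∀ x ∈ s u, x < n
  eq_nil_of_mem : ∀ u, ∀ x ∈ s u, s x = []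
  nodup : ∀ u, (s u).Nodup
  disjoint : ∀ u v, u ≠ v → (s u).Disjoint (s v)

lemma kept_of_eq_nil {F : Finset ℕ} {s : State} {u : ℕ} (h : s u = []) : kept F s u = [] := by
  simp [kept, h]

lemma step_eq_kept {n : ℕ} {F : Finset ℕ} {s : State} {v : ℕ}
    (h : ∀ u l, s u = v :: l → v ∈ F) : step n F s v = kept F s v := by
  have h0 : ∀ u, sent F s u v = [] := by
    intro u
    rcases hu : s u with _ | ⟨j, l⟩
    · simp [sent, hu]
    · simp only [sent, hu, ite_eq_right_iff, and_imp]
      rintro rfl hj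
      exact absurd (h u l hu) hj
  simp [step, h0]

lemma Reachable.step_eq_evenPart {n : ℕ} {F : Finset ℕ} {s : State} (hs : Reachable n s)
    {u v : ℕ} {l : List ℕ} (hu : s u = v :: l) (hv : v ∉ F) :
    step n F s v = evenPart l := by
  have hvu : v ∈ s u := by simp [hu]
  have hsent : ∀ w, sent F s w v = if w = u then evenPart l else [] := by
    intro w
    split_ifs with hw
    · simp [sent, hw, hu, hv]
    · rcases hw' : s w with _ | ⟨j, l'⟩
      · simp [sent, hw']
      · simp only [sent, hw', ite_eq_right_iff, and_imp]
        rintro rfl -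
        exact absurd hvu (fun h => hs.disjoint w u hw (by simp [hw']) h)
  have hun : u < n := hs.lt_of_ne_nil u (by simp [hu])
  have hflat : ∀ L : List ℕ, L.Nodup → u ∈ L →
      L.flatMap (fun w => if w = u then evenPart l else []) = evenPart l := by
    intro L hL huL
    obtain ⟨A, B, rfl⟩ := List.append_of_mem huL
    have hA : ∀ w ∈ A, w ≠ u := by
      rintro w hw rfl
      exact (List.nodup_append.1 hL).2.2 w hw w (by simp) rfl
    have hB : ∀ w ∈ B, w ≠ u := by
      rintro w hw rfl
      exact (List.nodup_cons.1 (List.nodup_append.1 hL).2.1).1 hw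
    rw [List.flatMap_append, List.flatMap_cons,
      List.flatMap_eq_nil_iff.2 (by simp +contextual [hA]),
      List.flatMap_eq_nil_iff.2 (by simp +contextual [hB])]
    simp
  simp only [step, hsent, kept_of_eq_nil (hs.eq_nil_of_mem u v hvu)]
  rw [hflat _ List.nodup_range (by simpa using hun)]
  simp

lemma Reachable.eq_of_mem {n : ℕ} {s : State} (hs : Reachable n s) {u v x : ℕ}
    (hu : x ∈ s u) (hv : x ∈ s v) : u = v := by
  by_contra h
  exact hs.disjoint u v h hu hv

/-- A processor holding a nonempty list is not contacted. -/
lemma Reachable.step_eq_kept_of_cons {n : ℕ} {F : Finset ℕ} {s : State} (hs : Reachable n s)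
    {u j : ℕ} {l : List ℕ} (hu : s u = j :: l) :
    step n F s u = if j ∈ F then l else oddPart l := by
  rw [step_eq_kept, kept, hu]
  intro w l' hw
  have := hs.eq_nil_of_mem w u (by simp [hw])
  simp [this] at hu

lemma Reachable.step_cases {n : ℕ} {s : State} (hs : Reachable n s) (F : Finset ℕ) (v : ℕ) :
    (∃ u l, s u = v :: l ∧ v ∉ F ∧ step n F s v = evenPart l) ∨
      (∃ j l, s v = j :: l ∧ step n F s v = if j ∈ F then l else oddPart l) ∨
      step n F s v = [] := by
  by_cases h : ∀ u l, s u = v :: l → v ∈ F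
  · right
    rcases hv : s v with _ | ⟨j, l⟩
    · exact Or.inr (by rw [step_eq_kept h, kept_of_eq_nil hv])
    · exact Or.inl ⟨j, l, rfl, hs.step_eq_kept_of_cons hv⟩
  · push Not at h
    obtain ⟨u, l, hu, hv⟩ := h
    exact Or.inl ⟨u, l, hu, hv, hs.step_eq_evenPart hu hv⟩

lemma Reachable.exists_of_mem_step {n : ℕ} {F : Finset ℕ} {s : State} (hs : Reachable n s)
    {v x : ℕ} (hx : x ∈ step n F s v) :
    ∃ u j l, s u = j :: l ∧ x ∈ l ∧
      ((v = j ∧ j ∉ F ∧ x ∈ evenPart l) ∨ (v = u ∧ (j ∉ F → x ∈ oddPart l))) := by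
  obtain ⟨u, l, hu, hv, h⟩ | ⟨j, l, hv, h⟩ | h := hs.step_cases F v
  · rw [h] at hx
    exact ⟨u, v, l, hu, mem_of_mem_evenPart hx, Or.inl ⟨rfl, hv, hx⟩⟩
  · rw [h] at hx
    refine ⟨v, j, l, hv, ?_, Or.inr ⟨rfl, fun hj => by rwa [if_neg hj] at hx⟩⟩
    split_ifs at hx
    · exact hx
    · exact mem_of_mem_oddPart hx
  · simp [h] at hx

lemma Reachable.step {n : ℕ} {s : State} (hs : Reachable n s) (F : Finset ℕ) :
    Reachable n (step n F s) := by
  have hnodup : ∀ {u j l}, s u = j :: l → j ∉ l ∧ (oddPart l ++ evenPart l).Nodup := by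
    intro u j l hu
    have := hs.nodup u
    rw [hu, List.nodup_cons] at this
    exact ⟨this.1, (oddPart_append_evenPart_perm l).nodup_iff.2 this.2⟩
  refine ⟨fun v hv => ?_, fun v x hx => ?_, fun v x hx => ?_, fun v => ?_,
    fun v w hvw x hx hx' => ?_⟩
  · obtain ⟨u, l, hu, -⟩ | ⟨j, l, hu, -⟩ | h := hs.step_cases F v
    · exact hs.lt_of_mem u v (by simp [hu])
    · exact hs.lt_of_ne_nil v (by simp [hu])
    · exact absurd h hv
  · obtain ⟨u, j, l, hu, hxl, -⟩ := hs.exists_of_mem_step hx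
    exact hs.lt_of_mem u x (by simp [hu, hxl])
  · obtain ⟨u, j, l, hu, hxl, -⟩ := hs.exists_of_mem_step hx
    have hxu : x ∈ s u := by simp [hu, hxl]
    rw [step_eq_kept, kept_of_eq_nil (hs.eq_nil_of_mem u x hxu)]
    intro w l' hw
    obtain rfl := hs.eq_of_mem (u := w) (by simp [hw]) hxu
    rw [hw, List.cons.injEq] at hu
    obtain ⟨rfl, rfl⟩ := hu
    exact absurd hxl (hnodup hw).1
  · obtain ⟨u, l, hu, -, h⟩ | ⟨j, l, hu, h⟩ | h := hs.step_cases F v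
    · rw [h]
      exact (List.nodup_append.1 (hnodup hu).2).2.1
    · rw [h]
      split_ifs
      · exact (oddPart_append_evenPart_perm l).nodup_iff.1 (hnodup hu).2
      · exact (List.nodup_append.1 (hnodup hu).2).1
    · simp [h]
  · obtain ⟨u, j, l, hu, hxl, h⟩ := hs.exists_of_mem_step hx
    obtain ⟨u', j', l', hu', hxl', h'⟩ := hs.exists_of_mem_step hx'
    obtain rfl := hs.eq_of_mem (u := u) (v := u') (x := x) (by simp [hu, hxl]) (by simp [hu', hxl'])
    rw [hu, List.cons.injEq] at hu'
    obtain ⟨rfl, rfl⟩ := hu'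
    have hd := (List.nodup_append.1 (hnodup hu).2).2.2
    rcases h with ⟨rfl, hj, he⟩ | ⟨rfl, ho⟩ <;> rcases h' with ⟨rfl, hj', he'⟩ | ⟨rfl, ho'⟩
    · exact hvw rfl
    · exact hd x (ho' hj) x he rfl
    · exact hd x (ho hj') x he' rfl
    · exact hvw rfl

lemma reachable_initial {n : ℕ} (hn : 0 < n) {L : List ℕ} (hL : L.Nodup)
    (hL' : ∀ x ∈ L, x ≠ 0 ∧ x < n) : Reachable n (initial L) := by
  constructor <;> intro u
  · by_cases hu : u = 0 <;> simp [initial, hu, hn]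
  · by_cases hu : u = 0
    · simpa [initial, hu] using fun x hx => (hL' x hx).2
    · simp [initial, hu]
  · by_cases hu : u = 0
    · simp only [initial, hu, if_true]
      intro x hx
      simp [(hL' x hx).1]
    · simp [initial, hu]
  · by_cases hu : u = 0 <;> simp [initial, hu, hL]
  · intro v huv
    by_cases hu : u = 0
    · have hv : v ≠ 0 := by rintro rfl; exact huv hu
      simp [initial, hv]
    · simp [initial, hu]

lemma reachable_stateAfter {n : ℕ} (hn : 0 < n) (F : Finset ℕ) {L : List ℕ} (hL : L.Nodup)
    (hL' : ∀ x ∈ L, x ≠ 0 ∧ x < n) (t : ℕ) : Reachable n (stateAfter n F L t) := by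
  induction t with
  | zero => exact reachable_initial hn hL hL'
  | succ t ih => exact ih.step F

/-- One round lowers the largest height of the pending request trees by one. -/
lemma Reachable.depth_step_le_iff {n : ℕ} {F : Finset ℕ} {s : State} (hs : Reachable n s) (k : ℕ) :
    (∀ v, depth F (GP.step n F s v) ≤ k) ↔ ∀ u, depth F (s u) ≤ k + 1 := by
  constructor
  · intro h u
    rcases hu : s u with _ | ⟨j, l⟩
    · simp [depth]
    · have h₁ := h u
      have h₂ := h j
      rw [hs.step_eq_kept_of_cons hu] at h₁
      rw [depth, Nat.add_le_add_iff_right]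
      split_ifs at h₁ ⊢ with hj
      · exact h₁
      · rw [hs.step_eq_evenPart hu hj] at h₂
        exact max_le h₁ h₂
  · intro h v
    obtain ⟨u, l, hu, hv, hst⟩ | ⟨j, l, hu, hst⟩ | hst := hs.step_cases F v
    · have := h u
      rw [hu, depth, if_neg hv, Nat.add_le_add_iff_right] at this
      rw [hst]
      exact (le_max_right _ _).trans this
    · have := h v
      rw [hu, depth, Nat.add_le_add_iff_right] at this
      rw [hst]
      split_ifs at this ⊢
      · exact this
      · exact (le_max_left _ _).trans this
    · simp [hst, depth]

lemma active_stateAfter_eq_empty_iff {n : ℕ} (hn : 0 < n) (F : Finset ℕ) {L : List ℕ}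
    (hL : L.Nodup) (hL' : ∀ x ∈ L, x ≠ 0 ∧ x < n) (t : ℕ) :
    active (stateAfter n F L t) = ∅ ↔ depth F L ≤ t := by
  have key : ∀ k, (∀ u, depth F (stateAfter n F L t u) ≤ k) ↔ depth F L ≤ k + t := by
    induction t with
    | zero =>
      intro k
      refine ⟨fun h => by simpa [stateAfter, initial] using h 0, fun h u => ?_⟩
      by_cases hu : u = 0
      · simpa [stateAfter, initial, hu] using h
      · simp [stateAfter, initial, hu, depth]
    | succ t ih =>
      intro k
      rw [stateAfter, (reachable_stateAfter hn F hL hL' t).depth_step_le_iff, ih, add_right_comm,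
        add_assoc]
  rw [← Nat.zero_add t, ← key 0, Nat.zero_add]
  simp [active, Set.eq_empty_iff_forall_notMem, depth_eq_zero_iff]

lemma hasTimeComplexity_depth {n : ℕ} (hn : 0 < n) (F : Finset ℕ) {L : List ℕ} (hL : L.Nodup)
    (hL' : ∀ x ∈ L, x ≠ 0 ∧ x < n) (hne : L ≠ []) : HasTimeComplexity n F L (depth F L) := by
  have hpos : depth F L ≠ 0 := fun h => hne ((depth_eq_zero_iff F L).1 h)
  refine ⟨depth F L - 1, by omega, ?_, ?_⟩
  · rw [Set.nonempty_iff_ne_empty, Ne, active_stateAfter_eq_empty_iff hn F hL hL']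
    omega
  · rw [active_stateAfter_eq_empty_iff hn F hL hL']
    omega

/-! ### Sampling without replacement -/

/-- Positions of a uniformly random permutation are negatively correlated: the probability that
`σ` maps all of `S` into `F` is at most its value for independent uniform positions. -/
lemma card_perm_forall_mem_le {α : Type*} [Fintype α] [DecidableEq α] (F S : Finset α) :
    (Finset.univ.filter fun σ : Equiv.Perm α => ∀ i ∈ S, σ i ∈ F).card * Fintype.card α ^ S.card ≤
      (Fintype.card α).factorial * F.card ^ S.card := by
  classical
  induction S using Finset.induction_on with
  | empty => simp [Fintype.card_perm]
  | insert a S ha ih =>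
    set N := Finset.univ.filter fun σ : Equiv.Perm α => ∀ i ∈ S, σ i ∈ F with hN
    set N' := fun b => N.filter fun σ : Equiv.Perm α => σ b ∈ F with hN'
    have hins : (Finset.univ.filter fun σ : Equiv.Perm α => ∀ i ∈ insert a S, σ i ∈ F) = N' a := by
      ext σ
      simp [hN, hN', and_comm]
    have hle : ∀ b, (N' a).card ≤ (N' b).card := by
      intro b
      by_cases hb : b ∈ S
      · refine Finset.card_le_card fun σ hσ => ?_
        simp only [hN', hN, Finset.mem_filter, Finset.mem_univ, true_and] at hσ ⊢
        exact ⟨hσ.1, hσ.1 b hb⟩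
      · -- Exchanging the positions `a` and `b` outside `S` matches the two events.
        refine Finset.card_le_card_of_injOn (fun σ => σ * Equiv.swap a b) ?_
          (mul_left_injective _).injOn
        intro σ hσ
        simp only [hN', hN, Finset.coe_filter, Finset.mem_filter, Finset.mem_univ, true_and,
          Set.mem_ofPred_eq, Equiv.Perm.mul_apply, Equiv.swap_apply_right] at hσ ⊢
        refine ⟨fun i hi => ?_, hσ.2⟩
        rw [Equiv.swap_apply_of_ne_of_ne (by rintro rfl; exact ha hi) (by rintro rfl; exact hb hi)]
        exact hσ.1 i hi
    have hsum : ∑ b, (N' b).card = N.card * F.card := by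
      have hb : ∀ σ : Equiv.Perm α, (Finset.univ.filter fun b => σ b ∈ F).card = F.card := by
        intro σ
        rw [← Finset.card_map σ.symm.toEmbedding (s := F)]
        congr 1
        ext b
        simp
      have := Finset.sum_card_bipartiteAbove_eq_sum_card_bipartiteBelow
        (s := (Finset.univ : Finset α)) (t := N) fun b σ => σ b ∈ F
      simp only [Finset.bipartiteAbove, Finset.bipartiteBelow, hb, Finset.sum_const,
        smul_eq_mul] at this
      exact this
    -- Averaging over all positions `b` replaces the conditioning on the event for `S`.
    have hmul : (N' a).card * Fintype.card α ≤ N.card * F.card := by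
      rw [← hsum, mul_comm, ← Finset.card_univ, ← smul_eq_mul]
      exact Finset.card_nsmul_le_sum _ _ _ fun b _ => hle b
    rw [hins, Finset.card_insert_of_notMem ha, pow_succ, pow_succ]
    calc (N' a).card * (Fintype.card α ^ S.card * Fintype.card α)
        = (N' a).card * Fintype.card α * Fintype.card α ^ S.card := by ring
      _ ≤ N.card * F.card * Fintype.card α ^ S.card := by gcongr
      _ = N.card * Fintype.card α ^ S.card * F.card := by ring
      _ ≤ (Fintype.card α).factorial * F.card ^ S.card * F.card := by gcongr
      _ = _ := by ring

/-- The moment generating function of sampling without replacement is at most that of sampling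
with replacement. -/
lemma sum_perm_prod_le {α : Type*} [Fintype α] [DecidableEq α] [Nonempty α] (F s : Finset α)
    {y : ℝ} (hy : 0 ≤ y) :
    ∑ σ : Equiv.Perm α, ∏ i ∈ s, (1 + if σ i ∈ F then y else 0) ≤
      (Fintype.card α).factorial * (1 + y * (F.card / Fintype.card α)) ^ s.card := by
  have hα : (0 : ℝ) < Fintype.card α := by exact_mod_cast Fintype.card_pos
  have hpow : (1 + y * ((F.card : ℝ) / Fintype.card α)) ^ s.card =
      ∑ S ∈ s.powerset, (y * (F.card / Fintype.card α)) ^ S.card := by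
    rw [← Finset.prod_const, Finset.prod_one_add]
    simp
  simp_rw [hpow, Finset.prod_one_add]
  rw [Finset.sum_comm, Finset.mul_sum]
  refine Finset.sum_le_sum fun S _ => ?_
  have hind : ∀ σ : Equiv.Perm α, ∏ i ∈ S, (if σ i ∈ F then y else 0) =
      if ∀ i ∈ S, σ i ∈ F then y ^ S.card else 0 := by
    intro σ
    rw [Finset.prod_ite_zero, Finset.prod_const]
    congr 1
  simp_rw [hind]
  rw [← Finset.sum_filter, Finset.sum_const, nsmul_eq_mul, mul_pow, div_pow, ← mul_assoc,
    mul_comm _ (y ^ _), mul_comm _ (y ^ _), mul_assoc]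
  refine mul_le_mul_of_nonneg_left ?_ (by positivity)
  rw [← mul_div_assoc, le_div_iff₀ (by positivity)]
  exact_mod_cast card_perm_forall_mem_le F S

/-- The weight of a list that gives `c` to every faulty and `1` to every nonfaulty entry. -/
lemma prod_mul_pow_countP (F : Finset ℕ) (c : ℝ) (l : List ℕ) :
    (l.map fun x => 1 + if x ∈ F then c - 1 else 0).prod * c ^ l.countP (· ∉ F) =
      c ^ l.length := by
  induction l with
  | nil => simp
  | cons x l ih =>
    rw [List.map_cons, List.prod_cons, List.length_cons, pow_succ, ← ih]
    by_cases hx : x ∈ F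
    · rw [List.countP_cons_of_neg (by simpa using hx), if_pos hx]
      ring
    · rw [List.countP_cons_of_pos (by simpa using hx), if_neg hx]
      ring

/-- This is `x ≤ sinh x` at `x = log c`. -/
lemma log_le_half_sub_inv {c : ℝ} (hc : 1 ≤ c) : Real.log c ≤ (c - c⁻¹) / 2 := by
  have h := Real.self_le_sinh_iff.2 (Real.log_nonneg hc)
  rwa [Real.sinh_eq, Real.exp_neg, Real.exp_log (by linarith)] at h

/-! ### Random lists and the union bound over branches -/

lemma length_permList (n : ℕ) (π : Equiv.Perm (Fin (n - 1))) : (permList n π).length = n - 1 := by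
  simp [permList]

lemma permList_injective (n : ℕ) : Function.Injective (permList n) := by
  intro π σ h
  ext i
  have := congrFun (List.ofFn_injective h) i
  simpa using this

lemma nodup_permList (n : ℕ) (π : Equiv.Perm (Fin (n - 1))) : (permList n π).Nodup := by
  rw [permList, List.nodup_ofFn]
  intro i j h
  exact π.injective (Fin.ext (by simpa using h))

lemma mem_permList {n : ℕ} {π : Equiv.Perm (Fin (n - 1))} {x : ℕ} (hx : x ∈ permList n π) :
    x ≠ 0 ∧ x < n := by
  rw [permList, List.mem_ofFn] at hx
  obtain ⟨i, rfl⟩ := hx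
  have := (π i).isLt
  omega

lemma exists_permList_eq {n : ℕ} {π : Equiv.Perm (Fin (n - 1))} {l : List ℕ}
    (h : l.Perm (permList n π)) : ∃ σ, permList n σ = l := by
  have hlen : l.length = n - 1 := h.length_eq.trans (length_permList n π)
  have hmem : ∀ i (hi : i < l.length), l[i] ≠ 0 ∧ l[i] < n := fun i hi =>
    mem_permList (h.subset (List.getElem_mem hi))
  have hnd : l.Nodup := h.nodup_iff.2 (nodup_permList n π)
  let g : Fin (n - 1) → Fin (n - 1) := fun i =>
    ⟨l[(i : ℕ)]'(by omega) - 1, by have := hmem i (by omega); omega⟩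
  have hg : Function.Injective g := by
    intro i j hij
    have hi := hmem i (by omega)
    have hj := hmem j (by omega)
    have : l[(i : ℕ)]'(by omega) = l[(j : ℕ)]'(by omega) := by
      have := congrArg Fin.val hij
      simp only [g] at this
      omega
    exact Fin.ext ((hnd.getElem_inj_iff).1 this)
  refine ⟨Equiv.ofBijective g (Finite.injective_iff_bijective.1 hg), ?_⟩
  refine List.ext_getElem (by simp [permList, hlen]) fun i h₁ h₂ => ?_
  have := hmem i h₂
  simp only [permList, List.getElem_ofFn, Equiv.ofBijective_apply, g]
  omega

/-- Along every branch, the statuses of the contacted processors have the same joint distribution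
as those of the first processors on the random list. -/
lemma card_explore_le (n : ℕ) (F : Finset ℕ) (b : List Bool) (P : List ℕ → Prop)
    [DecidablePred P] :
    (Finset.univ.filter fun π => P (explore F b (permList n π))).card ≤
      (Finset.univ.filter fun π => P (permList n π)).card := by
  choose g hg using fun π => exists_permList_eq (explore_perm F b (permList n π))
  refine Finset.card_le_card_of_injOn g (fun π hπ => ?_) ?_
  · simpa [hg] using hπ
  · refine Function.Injective.injOn fun π σ h => ?_
    have := congrArg (permList n) h
    rw [hg, hg] at this
    exact permList_injective n (explore_injective F b this)

/-- Chernoff bound for sampling without replacement, before optimising the constants. -/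
lemma card_countP_le_mul_pow_le {n : ℕ} (hn : 2 ≤ n) {F : Finset ℕ}
    (hF : F ⊆ Finset.Icc 1 (n - 1)) {c : ℝ} (hc : 1 ≤ c) {t : ℕ} (ht : t ≤ n - 1) (k : ℕ) :
    ((Finset.univ.filter fun π : Equiv.Perm (Fin (n - 1)) =>
        ((permList n π).take t).countP (· ∉ F) ≤ k).card : ℝ) * c ^ t ≤
      (n - 1).factorial * (1 + (c - 1) * (F.card / (n - 1 : ℕ))) ^ t * c ^ k := by
  classical
  have : Nonempty (Fin (n - 1)) := ⟨⟨0, by omega⟩⟩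
  set G : Finset (Fin (n - 1)) := Finset.univ.filter fun i => (i : ℕ) + 1 ∈ F with hG
  have hGcard : G.card = F.card := by
    refine Finset.card_bij (fun i _ => (i : ℕ) + 1) (by simp [hG]) ?_ ?_
    · intro i _ j _ h
      exact Fin.ext (by omega)
    · intro x hx
      have := Finset.mem_Icc.1 (hF hx)
      refine ⟨⟨x - 1, by omega⟩, ?_, by simp; omega⟩
      simp only [hG, Finset.mem_filter, Finset.mem_univ, true_and]
      rwa [Nat.sub_add_cancel this.1]
  set s : Finset (Fin (n - 1)) := Finset.univ.filter fun i => (i : ℕ) < t with hs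
  have hscard : s.card = t := by
    rw [hs, Fin.card_filter_val_lt, min_eq_right ht]
  have hprod : ∀ π : Equiv.Perm (Fin (n - 1)),
      (((permList n π).take t).map fun x => 1 + if x ∈ F then c - 1 else 0).prod =
        ∏ i ∈ s, (1 + if π i ∈ G then c - 1 else 0) := by
    intro π
    rw [List.map_take, permList, List.map_ofFn, List.prod_take_ofFn]
    simp [hG, hs]
  have hmgf := sum_perm_prod_le G s (sub_nonneg.2 hc)
  rw [hscard, hGcard, Fintype.card_fin] at hmgf
  refine le_trans ?_ (mul_le_mul_of_nonneg_right hmgf (by positivity))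
  rw [← nsmul_eq_mul, ← Finset.sum_const, Finset.sum_mul]
  have hnonneg : ∀ π : Equiv.Perm (Fin (n - 1)),
      0 ≤ ∏ i ∈ s, (1 + if π i ∈ G then c - 1 else 0) := by
    refine fun π => Finset.prod_nonneg fun i _ => ?_
    split_ifs <;> linarith
  refine (Finset.sum_le_sum fun π hπ => ?_).trans (Finset.sum_le_sum_of_subset_of_nonneg
    (Finset.filter_subset _ _) fun π _ _ => mul_nonneg (hnonneg π) (by positivity))
  have hlen : ((permList n π).take t).length = t := by
    rw [List.length_take, length_permList, min_eq_left ht]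
  have := prod_mul_pow_countP F c ((permList n π).take t)
  rw [hlen, hprod] at this
  rw [← this]
  exact mul_le_mul_of_nonneg_left (pow_le_pow_right₀ hc (Finset.mem_filter.1 hπ).2) (hnonneg π)

/-- Chernoff bound for the lower tail of sampling without replacement: if the expected number of
nonfaulty processors among the first `t` ones is at least `c * a`, then it is unlikely that this
number is at most `a`. -/
lemma card_countP_le_le {n : ℕ} (hn : 2 ≤ n) {F : Finset ℕ}
    (hF : F ⊆ Finset.Icc 1 (n - 1)) {c : ℝ} (hc : 1 < c) {t : ℕ} (ht : t ≤ n - 1) {k : ℕ} {a : ℝ}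
    (hk : (k : ℝ) ≤ a) (ha : c * a ≤ (1 - F.card / (n - 1 : ℕ)) * t) :
    ((Finset.univ.filter fun π : Equiv.Perm (Fin (n - 1)) =>
        ((permList n π).take t).countP (· ∉ F) ≤ k).card : ℝ) ≤
      (n - 1).factorial * Real.exp (-((c - 1) ^ 2 / (2 * c)) * a) := by
  have hc0 : 0 < c := by linarith
  have h := card_countP_le_mul_pow_le hn hF hc.le ht k
  set r : ℝ := F.card / (n - 1 : ℕ) with hr
  have hr0 : 0 ≤ r := by positivity
  have ha0 : 0 ≤ a := k.cast_nonneg.trans hk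
  rw [← le_div_iff₀ (by positivity)] at h
  refine h.trans ?_
  rw [mul_assoc, mul_div_assoc]
  refine mul_le_mul_of_nonneg_left ?_ (by positivity)
  have h₁ : (1 + (c - 1) * r) / c ≤ Real.exp (-((1 - c⁻¹) * (1 - r))) := by
    refine le_trans (le_of_eq ?_) (Real.add_one_le_exp _)
    field_simp
    ring
  have h₂ : c ^ k ≤ Real.exp (Real.log c * a) := by
    rw [← Real.rpow_natCast, Real.rpow_def_of_pos hc0]
    exact Real.exp_le_exp.2 (mul_le_mul_of_nonneg_left hk (Real.log_nonneg hc.le))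
  have hbase : 0 ≤ (1 + (c - 1) * r) / c := by
    have := mul_nonneg (sub_nonneg.2 hc.le) hr0
    positivity
  calc (1 + (c - 1) * r) ^ t * c ^ k / c ^ t = ((1 + (c - 1) * r) / c) ^ t * c ^ k := by
        rw [div_pow]; ring
    _ ≤ Real.exp (-((1 - c⁻¹) * (1 - r))) ^ t * Real.exp (Real.log c * a) := by gcongr
    _ = Real.exp (-((1 - c⁻¹) * ((1 - r) * t)) + Real.log c * a) := by
        rw [← Real.exp_nat_mul, ← Real.exp_add]
        congr 1
        ring
    _ ≤ Real.exp (-((c - 1) ^ 2 / (2 * c)) * a) := by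
        refine Real.exp_le_exp.2 ?_
        have hci : 0 ≤ 1 - c⁻¹ := sub_nonneg.2 (inv_le_one_of_one_le₀ hc.le)
        have e₁ := mul_le_mul_of_nonneg_left ha hci
        have e₂ := mul_le_mul_of_nonneg_right (log_le_half_sub_inv hc.le) ha0
        have e₃ : -((1 - c⁻¹) * (c * a)) + (c - c⁻¹) / 2 * a = -((c - 1) ^ 2 / (2 * c)) * a := by
          field_simp
          ring
        linarith

/-- Union bound over the branches of the request tree. -/
lemma card_le_depth_le {n : ℕ} (hn : 2 ≤ n) {F : Finset ℕ}
    (hF : F ⊆ Finset.Icc 1 (n - 1)) {c : ℝ} (hc : 1 < c) {t : ℕ} {a : ℝ}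
    (hk : (Nat.log 2 (n - 1) : ℝ) + 1 ≤ a) (ha : c * a ≤ (1 - F.card / (n - 1 : ℕ)) * t) :
    ((Finset.univ.filter fun π : Equiv.Perm (Fin (n - 1)) =>
        t ≤ depth F (permList n π)).card : ℝ) ≤
      n * ((n - 1).factorial * Real.exp (-((c - 1) ^ 2 / (2 * c)) * a)) := by
  classical
  by_cases ht : t ≤ n - 1
  swap
  · rw [Finset.filter_false_of_mem]
    · simp only [Finset.card_empty, Nat.cast_zero]
      positivity
    · intro π _ h
      have := depth_le_length F (permList n π)
      rw [length_permList] at this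
      omega
  set k := Nat.log 2 (n - 1) with hkdef
  set E : ℝ := (n - 1).factorial * Real.exp (-((c - 1) ^ 2 / (2 * c)) * a) with hE
  have hsub : (Finset.univ.filter fun π : Equiv.Perm (Fin (n - 1)) =>
      t ≤ depth F (permList n π)) ⊆
      (Finset.univ : Finset (List.Vector Bool k)).biUnion fun b => Finset.univ.filter fun π =>
        ((explore F b.1 (permList n π)).take t).countP (· ∉ F) ≤ k + 1 := by
    intro π hπ
    obtain ⟨b, hb, hcount⟩ := exists_branch_of_le_depth F k t (permList n π)
      (by rw [length_permList]; exact Nat.lt_pow_succ_log_self one_lt_two _)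
      (Finset.mem_filter.1 hπ).2
    exact Finset.mem_biUnion.2 ⟨⟨b, hb⟩, Finset.mem_univ _,
      Finset.mem_filter.2 ⟨Finset.mem_univ _, hcount⟩⟩
  have hbranch : ∀ b : List.Vector Bool k, ((Finset.univ.filter fun π =>
      ((explore F b.1 (permList n π)).take t).countP (· ∉ F) ≤ k + 1).card : ℝ) ≤ E := fun b =>
    (Nat.cast_le.2 (card_explore_le n F b.1 fun l => (l.take t).countP (· ∉ F) ≤ k + 1)).trans
      (card_countP_le_le hn hF hc ht (by push_cast; exact hk) ha)
  have hpow : 2 ^ k ≤ n := (Nat.pow_log_le_self 2 (by omega)).trans (Nat.sub_le _ _)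
  calc ((Finset.univ.filter fun π : Equiv.Perm (Fin (n - 1)) =>
        t ≤ depth F (permList n π)).card : ℝ)
      ≤ ∑ b : List.Vector Bool k, ((Finset.univ.filter fun π =>
          ((explore F b.1 (permList n π)).take t).countP (· ∉ F) ≤ k + 1).card : ℝ) := by
        exact_mod_cast (Finset.card_le_card hsub).trans Finset.card_biUnion_le
    _ ≤ ∑ _b : List.Vector Bool k, E := Finset.sum_le_sum fun b _ => hbranch b
    _ = (2 ^ k : ℕ) * E := by simp [card_vector]
    _ ≤ n * E := mul_le_mul_of_nonneg_right (by exact_mod_cast hpow) (by positivity)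

lemma permProb_eq (n : ℕ) (A : Set (Equiv.Perm (Fin (n - 1)))) [DecidablePred (· ∈ A)] :
    permProb n A = ((Finset.univ.filter (· ∈ A)).card : ℝ) / (n - 1).factorial := by
  rw [permProb, PMF.toOuterMeasure_uniformOfFintype_apply, Fintype.card_perm, Fintype.card_fin,
    Fintype.card_subtype]
  simp

end GP

theorem theorem3 (n : ℕ) (hn : 2 ≤ n) (ε : ℝ) (hε : ε = Real.sqrt (Real.log n / ((n : ℝ) - 1)))
    (F : Finset ℕ) (hF : F ⊆ Finset.Icc 1 (n - 1))
    (hf : (F.card : ℝ) < ((n : ℝ) - 1) * (1 - ε))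
    (p : ℝ) (hp : p = 1 - (F.card : ℝ) / ((n : ℝ) - 1))
    (c : ℝ) (hc : 1 < c) :
    1 - (n : ℝ) ^ 3 / ((n : ℝ) ^ 2 - 1) *
        Real.exp (-((c - 1) ^ 2 / (2 * c)) * ((⌈Real.logb 2 ((n : ℝ) - 1)⌉ : ℝ) - 1)) ≤
      GP.permProb n {π | ∃ T : ℕ, GP.HasTimeComplexity n F (GP.permList n π) T ∧
        (T : ℝ) ≤ c / (p - ε) * ((⌈Real.logb 2 ((n : ℝ) - 1)⌉ : ℝ) + 1)} := by
  classical
  have hn' : (2 : ℝ) ≤ n := by exact_mod_cast hn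
  have hcast : ((n - 1 : ℕ) : ℝ) = (n : ℝ) - 1 := by
    rw [Nat.cast_sub (by omega), Nat.cast_one]
  have hε0 : 0 ≤ ε := hε ▸ Real.sqrt_nonneg _
  have hpε : 0 < p - ε := by
    have := (div_lt_iff₀' (by linarith : (0 : ℝ) < n - 1)).2 hf
    linarith
  set ℓ : ℝ := (⌈Real.logb 2 ((n : ℝ) - 1)⌉ : ℝ) with hℓ
  have hk : (Nat.log 2 (n - 1) : ℝ) ≤ ℓ := by
    refine le_trans ?_ (Int.le_ceil _)
    rw [← hcast]
    exact Real.natLog_le_logb (n - 1) 2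
  have hℓ0 : 0 ≤ ℓ := (Nat.cast_nonneg _).trans hk
  set B : ℝ := c / (p - ε) * (ℓ + 1) with hB
  have hB0 : 0 ≤ B := by positivity
  -- The bound fails exactly if the height is at least the next integer `t` after `B`.
  set t := ⌊B⌋₊ + 1 with ht
  have hBt : B < t := by rw [ht]; exact_mod_cast Nat.lt_floor_add_one B
  have ha : c * (ℓ + 1) ≤ (1 - F.card / (n - 1 : ℕ)) * t := by
    rw [hcast, ← hp]
    calc c * (ℓ + 1) = (p - ε) * B := by rw [hB]; field_simp
      _ ≤ p * t := mul_le_mul (by linarith) hBt.le hB0 (by linarith)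
  have hbad := GP.card_le_depth_le hn hF hc (by linarith : _ ≤ ℓ + 1) ha
  set A : Set (Equiv.Perm (Fin (n - 1))) :=
    {π | ∃ T : ℕ, GP.HasTimeComplexity n F (GP.permList n π) T ∧ (T : ℝ) ≤ B} with hA
  have hcompl : ∀ π, π ∉ A → t ≤ GP.depth F (GP.permList n π) := by
    intro π hπ
    by_contra hlt
    refine hπ ⟨_, GP.hasTimeComplexity_depth (by omega) F (GP.nodup_permList n π)
      (fun x hx => GP.mem_permList hx) ?_, ?_⟩
    · rw [← List.length_pos_iff_ne_nil, GP.length_permList]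
      omega
    · exact (Nat.cast_le.2 (by omega : _ ≤ ⌊B⌋₊)).trans (Nat.floor_le hB0)
  have hcard : ((n - 1).factorial : ℝ) ≤ (Finset.univ.filter (· ∈ A)).card +
      n * ((n - 1).factorial * Real.exp (-((c - 1) ^ 2 / (2 * c)) * (ℓ + 1))) := by
    have h := Finset.card_filter_add_card_filter_not (s := Finset.univ) (· ∈ A)
    rw [Finset.card_univ, Fintype.card_perm, Fintype.card_fin] at h
    have h' : ((Finset.univ.filter fun π => π ∉ A).card : ℝ) ≤
        (Finset.univ.filter fun π => t ≤ GP.depth F (GP.permList n π)).card := by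
      exact_mod_cast Finset.card_le_card (Finset.monotone_filter_right _ fun π _ => hcompl π)
    have h'' : ((Finset.univ.filter (· ∈ A)).card : ℝ) + (Finset.univ.filter fun π => π ∉ A).card =
        (n - 1).factorial := by exact_mod_cast h
    linarith
  have hfac : (0 : ℝ) < (n - 1).factorial := by positivity
  have hexp : Real.exp (-((c - 1) ^ 2 / (2 * c)) * (ℓ + 1)) ≤
      Real.exp (-((c - 1) ^ 2 / (2 * c)) * (ℓ - 1)) := by
    have : 0 ≤ (c - 1) ^ 2 / (2 * c) := by positivity
    exact Real.exp_le_exp.2 (by nlinarith)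
  have hratio : (n : ℝ) ≤ (n : ℝ) ^ 3 / ((n : ℝ) ^ 2 - 1) := by
    rw [le_div_iff₀ (by nlinarith)]
    nlinarith
  have hmul := mul_le_mul hratio hexp (Real.exp_nonneg _) (by linarith)
  rw [GP.permProb_eq, le_div_iff₀ hfac]
  nlinarith
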